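/- Let $n\ge 1$ and let $\tau>0$, $\alpha$ be real. For a partition $\lambda=(\lambda_1\ge\dots\ge\lambda_n\ge 0)$ and a box $s=(i,j)$ of its Young diagram write $a_\lambda(s)=\lambda_i-j$, $l_\lambda(s)=\#\{k>i:\lambda_k\ge j\}$, $a'(s)=j-1$, $l'(s)=i-1$ and $b_\lambda(s)=\frac{\tau l_\lambda(s)+a_\lambda(s)+\tau}{\tau l_\lambda(s)+a_\lambda(s)+1}$, and for $\mu\subseteq\lambda$ put $\psi_{\lambda\setminus\mu}=\prod_s b_\mu(s)/b_\lambda(s)$, the product over the boxes $s$ of $\mu$ with $a_\lambda(s)>a_\mu(s)$ and $l_\lambda(s)=l_\mu(s)$. A reverse tableau $T$ of shape $\lambda$ is a filling of the boxes by $1,\dots,n$, strictly decreasing down columns and weakly decreasing along rows; put $\lambda^{(i)}=\{s: T(s)>i\}$ and $\psi_T=\prod_{i=1}^n\psi_{\lambda^{(i-1)}\setminus\lambda^{(i)}}$. The Okounkov polynomial is $$P_\lambda(x;\tau,\alpha)=\sum_T\psi_T\prod_{s\in\lambda}\Big[x_{T(s)}^2-\big(a'(s)+\tau(n-T(s)-l'(s))+\alpha\big)^2\Big],$$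 the sum over all reverse tableaux of shape $\lambda$, and $q_\lambda=(-1)^{|\lambda|}P_\lambda$. Consider the rank-two Hermitian symmetric domains ($n=2$) of type $I_{2,2+b}$, $b\in\mathbb Z_{\ge 0}$ (the pair $(\mathfrak u(b+2,2),\mathfrak u(b+2)+\mathfrak u(2))$), with restricted root multiplicities $d=2$ (medium roots) and $2b$ (short roots), and of type $II_2$ (the pair $(\mathfrak{sp}(2,\mathbb R),\mathfrak u(2))$), with $d=1$ and $b=0$. Put $\tau=d/2$, $\alpha=(b+1)/2$, $\rho_1=\tau+\alpha$, $\rho_2=\alpha$, and let $\mathcal C=\{x\in\mathbb R^2: x_1\ge x_2\ge 0\}$, $$\mathcal A_0=\{x\in\mathcal C: q_\lambda(x)\ge 0\text{ for all partitions }\lambda=(\lambda_1\ge\lambda_2\ge 0)\},$$ $$R(x)=\sum_{k=0}^\infty\frac{(\rho_2+x_2)_k(\rho_2-x_2)_k(\tfrac d2)_k}{(\rho_1+x_1)_k(\rho_1-x_1)_k\,k!},\qquad \mathcal B=\{x\in\mathcal C: q_{(1,0)}(x)\ge 0,\ q_{(1,1)}(x)\ge 0,\ R(x)\ge 0\},$$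 where $(a)_k=a(a+1)\cdots(a+k-1)$ and terms with vanishing numerator are read as $0$ (this matters only at $x=(\rho_1,\rho_2)$, where thus $R(x)=1$). Then the series $R(x)$ converges at every $x\in\mathcal C$ with $q_{(1,0)}(x)\ge 0$ and $q_{(1,1)}(x)\ge 0$; for type $I_{2,2+b}$ one has $\mathcal A_0=\mathcal B$; and for type $II_2$ one has $\mathcal A_0\subseteq\mathcal B$. -/

import Mathlib

namespace Shimura

/-- `lam = (lam 0 ≥ lam 1 ≥ ⋯ ≥ lam (n-1) ≥ 0)` is a partition with at most `n` parts.
Rows and columns are numbered from `0` throughout, so the row `i` and column `j` of this file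
are the row `i + 1` and column `j + 1` of the usual numbering. -/
def IsPartition {n : ℕ} (lam : Fin n → ℕ) : Prop := Antitone lam

/-- The boxes of the Young diagram of `lam`. -/
abbrev Box {n : ℕ} (lam : Fin n → ℕ) : Type := (i : Fin n) × Fin (lam i)

/-- Arm length of the box in row `i`, column `j` (used for boxes of `lam` only). -/
def arm {n : ℕ} (lam : Fin n → ℕ) (i : Fin n) (j : ℕ) : ℕ := lam i - (j + 1)

/-- Leg length: the number of rows below row `i` that reach column `j`. -/
def leg {n : ℕ} (lam : Fin n → ℕ) (i : Fin n) (j : ℕ) : ℕ :=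
  (Finset.univ.filter fun k : Fin n => i < k ∧ j < lam k).card

/-- `b_lam(s) = (τ l(s) + a(s) + τ) / (τ l(s) + a(s) + 1)`. -/
noncomputable def boxWeight (τ : ℝ) {n : ℕ} (lam : Fin n → ℕ) (i : Fin n) (j : ℕ) : ℝ :=
  (τ * (leg lam i j : ℝ) + (arm lam i j : ℝ) + τ) / (τ * (leg lam i j : ℝ) + (arm lam i j : ℝ) + 1)

/-- `ψ_{lam \ mu}`: the product of `b_mu(s) / b_lam(s)` over the boxes `s` of `mu` with
`a_lam(s) > a_mu(s)` and `l_lam(s) = l_mu(s)`. -/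
noncomputable def skewWeight (τ : ℝ) {n : ℕ} (lam mu : Fin n → ℕ) : ℝ :=
  ∏ s ∈ Finset.univ.filter (fun s : Box mu =>
      arm mu s.1 s.2 < arm lam s.1 s.2 ∧ leg lam s.1 s.2 = leg mu s.1 s.2),
    boxWeight τ mu s.1 s.2 / boxWeight τ lam s.1 s.2

/-- A reverse tableau of shape `lam`: a filling of the boxes, strictly decreasing down the columns
and weakly decreasing along the rows. The entry `T s : Fin n` stands for the number `T s + 1`
of `{1, …, n}`. -/
structure IsReverseTableau {n : ℕ} {lam : Fin n → ℕ} (T : Box lam → Fin n) : Prop where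
  col : ∀ s t : Box lam, s.1 < t.1 → (s.2 : ℕ) = (t.2 : ℕ) → T t < T s
  row : ∀ s t : Box lam, s.1 = t.1 → (s.2 : ℕ) ≤ (t.2 : ℕ) → T t ≤ T s

/-- The partition `lam⁽ⁱ⁾` of the boxes whose number `T s + 1` exceeds `i`, given by its row
lengths. -/
def layer {n : ℕ} {lam : Fin n → ℕ} (T : Box lam → Fin n) (i : ℕ) : Fin n → ℕ := fun r =>
  (Finset.univ.filter fun j : Fin (lam r) => i < (T ⟨r, j⟩ : ℕ) + 1).card

/-- `ψ_T`, the product of the weights of the successive layers `lam⁽ⁱ⁾ ⊇ lam⁽ⁱ⁺¹⁾`. -/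
noncomputable def tableauWeight (τ : ℝ) {n : ℕ} {lam : Fin n → ℕ} (T : Box lam → Fin n) : ℝ :=
  ∏ i ∈ Finset.range n, skewWeight τ (layer T i) (layer T (i + 1))

open Classical in
/-- The Okounkov (`BC_n` interpolation) polynomial `P_lam(x; τ, α)`: the sum over the reverse
tableaux `T` of `ψ_T ∏_s (x_{T(s)}² - (a'(s) + τ (n - T(s) - l'(s)) + α)²)`. -/
noncomputable def okounkov {n : ℕ} (τ α : ℝ) (lam : Fin n → ℕ) (x : Fin n → ℝ) : ℝ :=
  ∑ T ∈ Finset.univ.filter (fun T : Box lam → Fin n => IsReverseTableau T),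
    tableauWeight τ T * ∏ s : Box lam,
      (x (T s) ^ 2 -
        (((s.2 : ℕ) : ℝ) + τ * ((n : ℝ) - (((T s : ℕ) : ℝ) + 1) - ((s.1 : ℕ) : ℝ)) + α) ^ 2)

/-- The signed polynomial `q_lam = (-1)^{|lam|} P_lam`. -/
noncomputable def signedOkounkov {n : ℕ} (τ α : ℝ) (lam : Fin n → ℕ) (x : Fin n → ℝ) : ℝ :=
  (-1) ^ (∑ i, lam i) * okounkov τ α lam x

/-- The Weyl chamber `x_1 ≥ ⋯ ≥ x_n ≥ 0`. -/
def chamber (n : ℕ) : Set (Fin n → ℝ) := {x | Antitone x ∧ ∀ i, 0 ≤ x i}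

/-- The `k`-th term `(a_1)_k ⋯ (a_p)_k / ((b_1)_k ⋯ (b_q)_k k!)` of the hypergeometric series
`_pF_q(a; b; 1)`. -/
noncomputable def hypergeometricTerm (a b : List ℝ) (k : ℕ) : ℝ :=
  (a.map fun c => (ascPochhammer ℝ k).eval c).prod /
    (b.map fun c => (ascPochhammer ℝ k).eval c).prod / (k.factorial : ℝ)

/-- The rank two Hermitian symmetric domains considered here: type `I_{2,2+b}`, for the pair
`(𝔲(b+2,2), 𝔲(b+2) + 𝔲(2))`, and type `II_2`, for the pair `(𝔰𝔭(2,ℝ), 𝔲(2))`. -/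
inductive RankTwoDomain : Type
  | typeI (b : ℕ)
  | typeII

namespace RankTwoDomain

/-- The multiplicity `d` of the medium restricted roots `±ε₁ ± ε₂`. -/
def d : RankTwoDomain → ℕ
  | typeI _ => 2
  | typeII => 1

/-- Half the multiplicity `2b` of the short restricted roots `±ε₁, ±ε₂`. -/
def b : RankTwoDomain → ℕ
  | typeI b => b
  | typeII => 0

/-- `τ = d / 2`. -/
noncomputable def tau (D : RankTwoDomain) : ℝ := (D.d : ℝ) / 2

/-- `α = (b + 1) / 2`. -/
noncomputable def alpha (D : RankTwoDomain) : ℝ := ((D.b : ℝ) + 1) / 2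

/-- `ρ₁ = τ + α`. -/
noncomputable def rho1 (D : RankTwoDomain) : ℝ := D.tau + D.alpha

/-- `ρ₂ = α`. -/
noncomputable def rho2 (D : RankTwoDomain) : ℝ := D.alpha

/-- The polynomial `q_lam` of the domain. -/
noncomputable def q (D : RankTwoDomain) (lam : Fin 2 → ℕ) (x : Fin 2 → ℝ) : ℝ :=
  signedOkounkov D.tau D.alpha lam x

/-- The set `𝒜₀` of the points of the Weyl chamber at which all the `q_lam` are nonnegative. -/
def A0 (D : RankTwoDomain) : Set (Fin 2 → ℝ) :=
  {x | x ∈ chamber 2 ∧ ∀ lam : Fin 2 → ℕ, IsPartition lam → 0 ≤ D.q lam x}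

/-- The terms of the series `R`. On the points of the chamber with `q_{1,0}, q_{1,1} ≥ 0` the
denominators are nonzero, except at `x = ρ`, where the numerators vanish for `k ≥ 1`; as usual for
terminating series these terms are `0`. -/
noncomputable def rTerm (D : RankTwoDomain) (x : Fin 2 → ℝ) : ℕ → ℝ :=
  hypergeometricTerm [D.rho2 + x 1, D.rho2 - x 1, (D.d : ℝ) / 2] [D.rho1 + x 0, D.rho1 - x 0]

/-- `R(x) = ₃F₂(ρ₂ + x₂, ρ₂ - x₂, d/2; ρ₁ + x₁, ρ₁ - x₁; 1)`. -/
noncomputable def R (D : RankTwoDomain) (x : Fin 2 → ℝ) : ℝ := ∑' k, D.rTerm x k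

/-- `ℬ`, cut out by three inequalities. -/
def B (D : RankTwoDomain) : Set (Fin 2 → ℝ) :=
  {x | x ∈ chamber 2 ∧ 0 ≤ D.q ![1, 0] x ∧ 0 ≤ D.q ![1, 1] x ∧ 0 ≤ D.R x}

end RankTwoDomain

end Shimura

/-! A reverse tableau of shape `(l + m, l)` with entries in `{1, 2}` is fixed by the number `l + i`
of 2s in its first row, so `q_λ` is an explicit sum over `i ≤ m` (`signedOkounkov_two`). The
inequalities `q_{1,0}, q_{1,1} ≥ 0` leave two cases (`region_cases`). If `x₁ ≤ ρ₁` and `x₂ ≤ ρ₂`,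
every factor in sight is nonnegative, hence so are all `q_λ` and `R`. Otherwise `ρ₂ < x₂ < 1 + ρ₂`
and `x₁ < ρ₁`, and only the factor `ρ₂² - x₂²` of the sums and of `R` is negative. It is absent from
the sum when `l > 0`, so only the rows `(m)` matter.

For these, `q_(m)` is a positive multiple of a partial sum of `R` with weights at least 1
(`q_row_eq`), while all terms of `R` after the zeroth are nonpositive. Thus `q_(m) ≥ 0` for all `m`
makes all partial sums nonnegative, and `R ≥ 0` in the limit. If `τ = 1` the weights equal 1 and the
partial sums decrease to `R`, which gives the converse. -/

namespace Shimura

/-! ### Okounkov polynomials in two variables -/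

open Finset

/-- The weight of a box with arm length `a` and leg length `0`. -/
noncomputable def rowWeight (τ : ℝ) (a : ℕ) : ℝ := ((a : ℝ) + τ) / ((a : ℝ) + 1)

/-- The weight of the tableau of shape `(l + m, l)` with `l + i` entries equal to `2`. -/
noncomputable def stripWeight (τ : ℝ) (m i : ℕ) : ℝ :=
  ∏ j ∈ range i, rowWeight τ (i - (j + 1)) / rowWeight τ (m - (j + 1))

/-- The reverse tableau of shape `(l + m, l)` whose first row has `l + i` entries equal to `2`. -/
def stripTableau (l m i : ℕ) (s : Box ![l + m, l]) : Fin 2 :=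
  if s.1 = 0 ∧ (s.2 : ℕ) < l + i then 1 else 0

theorem rowWeight_pos {τ : ℝ} (hτ : 0 < τ) (a : ℕ) : 0 < rowWeight τ a := by
  unfold rowWeight; positivity

theorem rowWeight_le_one {τ : ℝ} (hτ : τ ≤ 1) (a : ℕ) : rowWeight τ a ≤ 1 := by
  unfold rowWeight
  rw [div_le_one (by positivity)]
  linarith

theorem rowWeight_one (a : ℕ) : rowWeight 1 a = 1 := by
  unfold rowWeight
  exact div_self (by positivity)

theorem stripWeight_pos {τ : ℝ} (hτ : 0 < τ) (m i : ℕ) : 0 < stripWeight τ m i :=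
  prod_pos fun _ _ => div_pos (rowWeight_pos hτ _) (rowWeight_pos hτ _)

/-- For `τ ≤ 1` the denominators in `stripWeight` are at most 1. This makes the weights in
`q_row_eq` at least 1. -/
theorem prod_rowWeight_le_stripWeight {τ : ℝ} (hτ : 0 < τ) (hτ1 : τ ≤ 1) (m i : ℕ) :
    ∏ j ∈ range i, rowWeight τ j ≤ stripWeight τ m i := by
  rw [← prod_range_reflect, stripWeight]
  refine prod_le_prod (fun _ _ => (rowWeight_pos hτ _).le) fun j _ => ?_
  rw [show i - 1 - j = i - (j + 1) by omega]
  exact le_div_self (rowWeight_pos hτ _).le (rowWeight_pos hτ _) (rowWeight_le_one hτ1 _)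

theorem stripWeight_one (m i : ℕ) : stripWeight 1 m i = 1 := by
  simp [stripWeight, rowWeight_one]

theorem isReverseTableau_stripTableau {l m i : ℕ} : IsReverseTableau (stripTableau l m i) where
  col := by
    rintro ⟨s, j⟩ ⟨t, k⟩ h hjk
    fin_cases s <;> fin_cases t <;> simp at h hjk ⊢
    have hk : (k : ℕ) < l := k.2
    simp only [stripTableau]
    rw [if_neg (by simp), if_pos (by simp; omega)]
    simp
  row := by
    rintro ⟨s, j⟩ ⟨t, k⟩ h hjk
    obtain rfl : s = t := h
    simp only [stripTableau] at hjk ⊢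
    split_ifs with h1 h2
    · exact le_rfl
    · exact absurd ⟨h1.1, hjk.trans_lt h1.2⟩ h2
    · exact Fin.zero_le _
    · exact le_rfl

theorem stripTableau_injOn (l m : ℕ) : Set.InjOn (stripTableau l m) (Set.Iic m) := by
  have key : ∀ i k : ℕ, i < k → k ≤ m → stripTableau l m i ≠ stripTableau l m k := by
    intro i k hik hk h
    have := congrFun h ⟨0, ⟨l + i, show l + i < l + m by omega⟩⟩
    simp [stripTableau, hik] at this
  intro i hi k hk h
  rcases lt_trichotomy i k with h1 | h1 | h1
  · exact absurd h (key i k h1 hk)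
  · exact h1
  · exact absurd h.symm (key k i h1 hi)

theorem exists_eq_stripTableau {l m : ℕ} {T : Box ![l + m, l] → Fin 2} (hT : IsReverseTableau T) :
    ∃ i ≤ m, T = stripTableau l m i := by
  have top : ∀ j : Fin (l + m), (j : ℕ) < l → T ⟨0, j⟩ = 1 ∧ ∀ k : Fin l, (k : ℕ) = j →
      T ⟨1, k⟩ = 0 := by
    intro j hj
    have h := hT.col ⟨0, j⟩ ⟨1, (⟨j, hj⟩ : Fin l)⟩ (by simp) rfl
    refine ⟨by omega, fun k hk => ?_⟩
    obtain rfl : k = ⟨j, hj⟩ := Fin.ext hk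
    omega
  classical
  -- The least such `i` marks the first entry 1 of the first row past column `l`, or the end of the
  -- row.
  have hex : ∃ i, i = m ∨ ∃ h : l + i < l + m, T ⟨0, (⟨l + i, h⟩ : Fin (l + m))⟩ = 0 :=
    ⟨m, Or.inl rfl⟩
  have him : Nat.find hex ≤ m := Nat.find_min' hex (Or.inl rfl)
  refine ⟨Nat.find hex, him, ?_⟩
  funext ⟨s, j⟩
  fin_cases s
  · change T ⟨0, j⟩ = stripTableau l m (Nat.find hex) ⟨0, j⟩
    have hjlt : (j : ℕ) < l + m := j.2
    by_cases hj : (j : ℕ) < l + Nat.find hex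
    · simp only [stripTableau, hj, and_self, if_true]
      by_cases hjl : (j : ℕ) < l
      · exact (top j hjl).1
      · have h := Nat.find_min hex (m := j - l) (by omega)
        push Not at h
        have h2 := h.2 (by omega)
        have e : (⟨l + (j - l), by omega⟩ : Fin (l + m)) = j := Fin.ext (by simp; omega)
        rw [e] at h2
        omega
    · simp only [stripTableau, hj, and_false, if_false]
      rcases Nat.find_spec hex with h | ⟨h, h0⟩
      · omega
      · have := hT.row ⟨0, (⟨l + Nat.find hex, h⟩ : Fin (l + m))⟩ ⟨0, j⟩ rfl (by simpa using hj)
        rw [h0] at this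
        exact le_antisymm this (Fin.zero_le _)
  · change T ⟨1, j⟩ = stripTableau l m (Nat.find hex) ⟨1, j⟩
    have hj : (j : ℕ) < l := j.2
    rw [(top ⟨j, by omega⟩ hj).2 j rfl]
    simp [stripTableau]

theorem layer_zero {n : ℕ} {lam : Fin n → ℕ} (T : Box lam → Fin n) : layer T 0 = lam := by
  funext r
  simp [layer]

theorem layer_stripTableau_one {l m i : ℕ} (hi : i ≤ m) :
    layer (stripTableau l m i) 1 = ![l + i, 0] := by
  funext r
  fin_cases r
  · have e : ∀ j : Fin (l + m), (1 < (stripTableau l m i ⟨0, j⟩ : ℕ) + 1) ↔ (j : ℕ) < l + i := by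
      intro j
      by_cases h : (j : ℕ) < l + i <;> simp [stripTableau, h]
    change (univ.filter fun j : Fin (l + m) => 1 < (stripTableau l m i ⟨0, j⟩ : ℕ) + 1).card = l + i
    simp only [e]
    rw [Fin.card_filter_val_lt]
    omega
  · simp [layer, stripTableau]
    rfl

theorem layer_stripTableau_two {l m i : ℕ} : layer (stripTableau l m i) 2 = fun _ => 0 := by
  funext r
  simp only [layer, card_eq_zero, filter_eq_empty_iff]
  intro j _
  omega

/-- In the first `l` columns the leg drops from 1 to 0, so these boxes do not count. Beyond them all
legs are 0. For `i = m` the arms agree and no box counts, but then the factors of `stripWeight` are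
1 as well. -/
theorem skewWeight_strip {τ : ℝ} (hτ : 0 < τ) {l m i : ℕ} (hi : i ≤ m) :
    skewWeight τ ![l + m, l] ![l + i, 0] = stripWeight τ m i := by
  have hleg : ∀ j, leg ![l + i, 0] 0 j = 0 := by
    intro j
    simp only [leg, card_eq_zero, filter_eq_empty_iff]
    intro k _
    fin_cases k <;> simp
  have hleg1 : ∀ j < l, leg ![l + m, l] 0 j ≠ 0 := by
    intro j hj
    simp only [leg, Ne, card_eq_zero, filter_eq_empty_iff]
    intro h
    exact h (mem_univ 1) (by simpa using hj)
  have hleg0 : ∀ j, l ≤ j → leg ![l + m, l] 0 j = 0 := by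
    intro j hj
    simp only [leg, card_eq_zero, filter_eq_empty_iff]
    intro k _
    fin_cases k <;> simp [hj]
  rw [skewWeight, prod_filter, Fintype.prod_sigma, Fin.prod_univ_two]
  change (∏ j : Fin (l + i), _) * (∏ j : Fin 0, _) = _
  rw [Fin.prod_univ_zero, mul_one]
  rw [Fin.prod_univ_eq_prod_range (fun j : ℕ =>
    if arm ![l + i, 0] 0 j < arm ![l + m, l] 0 j ∧ leg ![l + m, l] 0 j = leg ![l + i, 0] 0 j then
      boxWeight τ ![l + i, 0] 0 j / boxWeight τ ![l + m, l] 0 j else 1) (l + i),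
    prod_range_add, prod_eq_one, one_mul, stripWeight]
  · refine prod_congr rfl fun j hj => ?_
    have hj' := mem_range.1 hj
    have h1 : arm ![l + i, 0] 0 (l + j) = i - (j + 1) := by
      simp only [arm, Matrix.cons_val_zero]; omega
    have h2 : arm ![l + m, l] 0 (l + j) = m - (j + 1) := by
      simp only [arm, Matrix.cons_val_zero]; omega
    simp only [boxWeight, hleg, hleg0 _ (Nat.le_add_right l j), h1, h2, and_true]
    split_ifs with h
    · simp [rowWeight]
    · obtain rfl : i = m := by omega
      rw [div_self (rowWeight_pos hτ _).ne']
  · intro j hj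
    rw [if_neg]
    rw [hleg]
    exact fun h => hleg1 j (mem_range.1 hj) h.2

theorem tableauWeight_stripTableau {τ : ℝ} (hτ : 0 < τ) {l m i : ℕ} (hi : i ≤ m) :
    tableauWeight τ (stripTableau l m i) = stripWeight τ m i := by
  rw [tableauWeight, prod_range_succ, prod_range_one, layer_zero, layer_stripTableau_one hi,
    layer_stripTableau_two, skewWeight_strip hτ hi]
  have : skewWeight τ ![l + i, 0] (fun _ : Fin 2 => 0) = 1 := by
    rw [skewWeight]
    exact prod_eq_one fun s _ => s.2.elim0
  rw [this, mul_one]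

theorem signedOkounkov_eq_sum {n : ℕ} (τ α : ℝ) (lam : Fin n → ℕ) (x : Fin n → ℝ)
    [DecidablePred fun T : Box lam → Fin n => IsReverseTableau T] :
    signedOkounkov τ α lam x =
      ∑ T ∈ univ.filter (fun T : Box lam → Fin n => IsReverseTableau T),
        tableauWeight τ T * ∏ s : Box lam,
          ((((s.2 : ℕ) : ℝ) + τ * ((n : ℝ) - (((T s : ℕ) : ℝ) + 1) - ((s.1 : ℕ) : ℝ)) + α) ^ 2 -
            x (T s) ^ 2) := by
  rw [signedOkounkov, okounkov, mul_sum]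
  refine sum_congr (by congr) fun T _ => ?_
  have hc : ∑ i, lam i = #(univ : Finset (Box lam)) := by simp
  rw [mul_left_comm, hc, ← prod_neg]
  simp

/-- The explicit form of the Okounkov polynomials in two variables. -/
theorem signedOkounkov_two {τ : ℝ} (hτ : 0 < τ) (α : ℝ) (l m : ℕ) (x : Fin 2 → ℝ) :
    signedOkounkov τ α ![l + m, l] x =
      (∏ j ∈ range l, (((j : ℝ) + α) ^ 2 - x 0 ^ 2) * (((j : ℝ) + α) ^ 2 - x 1 ^ 2)) *
        ∑ i ∈ range (m + 1), stripWeight τ m i *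
          ((∏ j ∈ range i, (((l + j : ℕ) + α) ^ 2 - x 1 ^ 2)) *
            ∏ j ∈ range (m - i), (((l + (i + j) : ℕ) + τ + α) ^ 2 - x 0 ^ 2)) := by
  classical
  rw [signedOkounkov_eq_sum, mul_sum]
  symm
  refine sum_bij (fun i _ => stripTableau l m i) ?_ ?_ ?_ ?_
  · exact fun i _ => mem_filter.2 ⟨mem_univ _, isReverseTableau_stripTableau⟩
  · intro i hi k hk h
    exact stripTableau_injOn l m (Set.mem_Iic.2 (by simpa [Nat.lt_succ_iff] using hi))
      (Set.mem_Iic.2 (by simpa [Nat.lt_succ_iff] using hk)) h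
  · intro T hT
    obtain ⟨i, hi, rfl⟩ := exists_eq_stripTableau (mem_filter.1 hT).2
    exact ⟨i, mem_range.2 (by omega), rfl⟩
  · intro i hi
    have him : i ≤ m := by have := mem_range.1 hi; omega
    rw [tableauWeight_stripTableau hτ him, mul_left_comm]
    congr 1
    rw [Fintype.prod_sigma, Fin.prod_univ_two]
    -- The shift `τ (2 - T(s) - l'(s))` is `τ` for an entry 1 in the first row, and 0 for all other
    -- boxes.
    have row0 : (∏ j : Fin (l + m),
        ((((j : ℕ) : ℝ) + τ * (((2 : ℕ) : ℝ) - (((stripTableau l m i ⟨0, j⟩ : ℕ) : ℝ) + 1)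
          - (((0 : Fin 2) : ℕ) : ℝ)) + α) ^ 2 - x (stripTableau l m i ⟨0, j⟩) ^ 2)) =
        (∏ j ∈ range l, (((j : ℝ) + α) ^ 2 - x 1 ^ 2)) *
          ((∏ j ∈ range i, (((l + j : ℕ) + α) ^ 2 - x 1 ^ 2)) *
            ∏ j ∈ range (m - i), (((l + (i + j) : ℕ) + τ + α) ^ 2 - x 0 ^ 2)) := by
      have e : ∀ j : Fin (l + m),
          ((((j : ℕ) : ℝ) + τ * (((2 : ℕ) : ℝ) - (((stripTableau l m i ⟨0, j⟩ : ℕ) : ℝ) + 1)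
            - (((0 : Fin 2) : ℕ) : ℝ)) + α) ^ 2 - x (stripTableau l m i ⟨0, j⟩) ^ 2) =
          (fun j : ℕ => if j < l + i then ((j : ℝ) + α) ^ 2 - x 1 ^ 2
            else ((j : ℝ) + τ + α) ^ 2 - x 0 ^ 2) j := by
        intro j
        by_cases h : (j : ℕ) < l + i
        · simp [stripTableau, h]; ring
        · simp [stripTableau, h]; ring
      rw [prod_congr rfl fun j _ => e j, Fin.prod_univ_eq_prod_range (fun j : ℕ =>
        if j < l + i then ((j : ℝ) + α) ^ 2 - x 1 ^ 2 else ((j : ℝ) + τ + α) ^ 2 - x 0 ^ 2) (l + m)]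
      obtain ⟨k, rfl⟩ := Nat.exists_eq_add_of_le him
      rw [prod_range_add]
      congr 1
      · refine prod_congr rfl fun j hj => if_pos ?_
        have := mem_range.1 hj
        omega
      · rw [prod_range_add, Nat.add_sub_cancel_left]
        congr 1
        · refine prod_congr rfl fun j hj => if_pos ?_
          have := mem_range.1 hj
          omega
        · exact prod_congr rfl fun j hj => if_neg (by omega)
    have row1 : (∏ j : Fin l,
        ((((j : ℕ) : ℝ) + τ * (((2 : ℕ) : ℝ) - (((stripTableau l m i ⟨1, j⟩ : ℕ) : ℝ) + 1)
          - (((1 : Fin 2) : ℕ) : ℝ)) + α) ^ 2 - x (stripTableau l m i ⟨1, j⟩) ^ 2)) =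
        ∏ j ∈ range l, (((j : ℝ) + α) ^ 2 - x 0 ^ 2) := by
      rw [← Fin.prod_univ_eq_prod_range (fun j : ℕ => ((j : ℝ) + α) ^ 2 - x 0 ^ 2)]
      refine prod_congr rfl fun j _ => ?_
      simp [stripTableau]
      ring
    refine Eq.trans ?_ (congrArg₂ (· * ·) row0.symm row1.symm)
    rw [prod_mul_distrib]
    ring

end Shimura

/-! ### Convergence of `R` -/

namespace Shimura

open Finset Filter

theorem ascPochhammer_eval_eq_prod (k : ℕ) (c : ℝ) :
    (ascPochhammer ℝ k).eval c = ∏ j ∈ range k, (c + j) := by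
  induction k with
  | zero => simp
  | succ k ih => rw [ascPochhammer_succ_eval, ih, prod_range_succ]

/-- Raabe's test, for a recursion `t (k + 1) * B k = t k * A k`. -/
theorem summable_of_raabe {t A B : ℕ → ℝ} {ε : ℝ} (hε : 0 < ε)
    (hrec : ∀ᶠ k in atTop, t (k + 1) * B k = t k * A k)
    (hA : ∀ᶠ k in atTop, 0 < A k) (hB : ∀ᶠ k in atTop, 0 < B k)
    (hAB : ∀ᶠ k : ℕ in atTop, (k + 1 + ε) * A k ≤ k * B k) : Summable t := by
  obtain ⟨K, hK⟩ := eventually_atTop.1 (hrec.and (hA.and (hB.and hAB)))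
  rw [← summable_nat_add_iff (K + 1)]
  -- The right side telescopes, which bounds the partial sums of `ε * |t|`.
  have step : ∀ k, K ≤ k → ε * |t (k + 1)| ≤ k * |t k| - (k + 1 : ℕ) * |t (k + 1)| := by
    intro k hk
    obtain ⟨h1, h2, h3, h4⟩ := hK k hk
    have e : |t (k + 1)| * B k = |t k| * A k := by
      rw [← abs_of_pos h3, ← abs_mul, h1, abs_mul, abs_of_pos h2]
    have : (k + 1 + ε) * |t (k + 1)| * A k ≤ k * |t k| * A k := by
      calc (k + 1 + ε) * |t (k + 1)| * A k = ((k + 1 + ε) * A k) * |t (k + 1)| := by ring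
        _ ≤ (k * B k) * |t (k + 1)| := mul_le_mul_of_nonneg_right h4 (abs_nonneg _)
        _ = k * (|t (k + 1)| * B k) := by ring
        _ = k * |t k| * A k := by rw [e]; ring
    have := le_of_mul_le_mul_right this h2
    push_cast
    linarith
  have hsum : ∀ n, ∑ k ∈ range n, |t (k + (K + 1))| ≤ K * |t K| / ε := by
    intro n
    rw [le_div_iff₀ hε]
    have : ε * ∑ k ∈ range n, |t (k + (K + 1))| ≤ K * |t K| - (n + K : ℕ) * |t (n + K)| := by
      induction n with
      | zero => simp
      | succ n ih =>
        rw [sum_range_succ, mul_add]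
        have := step (n + K) (by omega)
        rw [show n + 1 + K = n + K + 1 by omega, show n + (K + 1) = n + K + 1 by omega]
        linarith
    have h0 : 0 ≤ ((n + K : ℕ) : ℝ) * |t (n + K)| := by positivity
    linarith
  exact (summable_of_sum_range_le (fun _ => abs_nonneg _) hsum).of_abs

theorem eventually_sq_sub_sq_pos (r y : ℝ) : ∀ᶠ k : ℕ in atTop, 0 < ((k : ℝ) + r) ^ 2 - y ^ 2 := by
  filter_upwards [tendsto_natCast_atTop_atTop.eventually_gt_atTop (|y| - r)] with k hk
  have : |y| < |(k : ℝ) + r| := lt_of_lt_of_le (by linarith) (le_abs_self _)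
  linarith [sq_lt_sq.2 this]

theorem eventually_cubic_nonneg {c : ℝ} (hc : 0 < c) (c₂ c₁ c₀ : ℝ) :
    ∀ᶠ k : ℕ in atTop, 0 ≤ c * (k : ℝ) ^ 3 + c₂ * (k : ℝ) ^ 2 + c₁ * k + c₀ := by
  filter_upwards [tendsto_natCast_atTop_atTop.eventually_ge_atTop ((|c₂| + |c₁| + |c₀|) / c),
    eventually_ge_atTop 1] with k hk hk1
  have h1 : (1 : ℝ) ≤ k := by exact_mod_cast hk1
  rw [div_le_iff₀ hc] at hk
  generalize (k : ℝ) = y at *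
  have e2 : -|c₂| * y ^ 2 ≤ c₂ * y ^ 2 := mul_le_mul_of_nonneg_right (neg_abs_le _) (by positivity)
  have e1 : -|c₁| * y ^ 2 ≤ c₁ * y := by
    nlinarith [neg_abs_le c₁, abs_nonneg c₁, mul_nonneg (abs_nonneg c₁) (by nlinarith : 0 ≤ y ^ 2 - y)]
  have e0 : -|c₀| * y ^ 2 ≤ c₀ := by
    nlinarith [neg_abs_le c₀, mul_nonneg (abs_nonneg c₀) (by nlinarith : 0 ≤ y ^ 2 - 1)]
  nlinarith [mul_le_mul_of_nonneg_right hk (sq_nonneg y)]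

namespace RankTwoDomain

variable (D : RankTwoDomain)

theorem tau_pos : 0 < D.tau := by cases D <;> simp [tau, d]

theorem tau_le_one : D.tau ≤ 1 := by cases D <;> norm_num [tau, d]

theorem alpha_pos : 0 < D.alpha := by unfold alpha; positivity

theorem rTerm_eq_prod (x : Fin 2 → ℝ) (k : ℕ) :
    D.rTerm x k = ∏ j ∈ range k, (((j : ℝ) + D.alpha) ^ 2 - x 1 ^ 2) * ((j : ℝ) + D.tau) /
      ((((j : ℝ) + D.tau + D.alpha) ^ 2 - x 0 ^ 2) * ((j : ℝ) + 1)) := by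
  have hf : (k.factorial : ℝ) = ∏ j ∈ range k, ((j : ℝ) + 1) := by
    rw [← prod_range_add_one_eq_factorial]
    push_cast
    rfl
  simp only [rTerm, hypergeometricTerm, List.map_cons, List.map_nil, List.prod_cons, List.prod_nil,
    mul_one, ascPochhammer_eval_eq_prod, hf, ← prod_mul_distrib, ← prod_div_distrib]
  refine prod_congr rfl fun j _ => ?_
  rw [div_div]
  simp only [rho1, rho2]
  congr 1
  · rw [show (D.d : ℝ) / 2 = D.tau from rfl]; ring
  · ring

/-- Raabe's test needs the recursion only for large `k`, so vanishing denominators, where division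
yields 0, do no harm. -/
theorem summable_rTerm (x : Fin 2 → ℝ) : Summable (D.rTerm x) := by
  have hτ := D.tau_pos
  have hA := eventually_sq_sub_sq_pos D.alpha (x 1)
  have hB := eventually_sq_sub_sq_pos (D.tau + D.alpha) (x 0)
  simp only [← add_assoc] at hB
  refine summable_of_raabe (ε := D.tau / 2) (by linarith)
    (A := fun j => (((j : ℝ) + D.alpha) ^ 2 - x 1 ^ 2) * ((j : ℝ) + D.tau))
    (B := fun j => (((j : ℝ) + D.tau + D.alpha) ^ 2 - x 0 ^ 2) * ((j : ℝ) + 1)) ?_ ?_ ?_ ?_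
  · filter_upwards [hB] with k hk
    rw [rTerm_eq_prod, rTerm_eq_prod, prod_range_succ, mul_assoc, div_mul_cancel₀]
    positivity
  · filter_upwards [hA] with k hk
    positivity
  · filter_upwards [hB] with k hk
    positivity
  · set τ := D.tau
    set α := D.alpha
    -- In `k * B k - (k + 1 + ε) * A k` the quartic terms cancel and the cubic coefficient is `τ - ε
    -- = τ / 2`.
    filter_upwards [eventually_cubic_nonneg (half_pos hτ)
      ((τ + α) ^ 2 - x 0 ^ 2 + 2 * (τ + α) -
        (α ^ 2 - x 1 ^ 2 + 2 * α * (τ + 1 + τ / 2) + τ * (1 + τ / 2)))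
      ((τ + α) ^ 2 - x 0 ^ 2 - ((α ^ 2 - x 1 ^ 2) * (τ + 1 + τ / 2) + 2 * α * (τ * (1 + τ / 2))))
      (-((α ^ 2 - x 1 ^ 2) * (τ * (1 + τ / 2))))] with k hk
    linarith

end RankTwoDomain

end Shimura

/-! ### Comparison of `𝒜₀` with `ℬ` -/

namespace Shimura

open Finset Filter

namespace RankTwoDomain

variable (D : RankTwoDomain)

theorem q_eq (l m : ℕ) (x : Fin 2 → ℝ) :
    D.q ![l + m, l] x =
      (∏ j ∈ range l, (((j : ℝ) + D.alpha) ^ 2 - x 0 ^ 2) * (((j : ℝ) + D.alpha) ^ 2 - x 1 ^ 2)) *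
        ∑ i ∈ range (m + 1), stripWeight D.tau m i *
          ((∏ j ∈ range i, (((l + j : ℕ) + D.alpha) ^ 2 - x 1 ^ 2)) *
            ∏ j ∈ range (m - i), (((l + (i + j) : ℕ) + D.tau + D.alpha) ^ 2 - x 0 ^ 2)) :=
  signedOkounkov_two D.tau_pos D.alpha l m x

theorem q_one_zero (x : Fin 2 → ℝ) :
    D.q ![1, 0] x = D.alpha ^ 2 + (D.tau + D.alpha) ^ 2 - x 0 ^ 2 - x 1 ^ 2 := by
  have h := D.q_eq 0 1 x
  have hw := (rowWeight_pos D.tau_pos 0).ne'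
  simp [sum_range_succ, stripWeight, hw] at h
  rw [h]
  ring

theorem q_one_one (x : Fin 2 → ℝ) :
    D.q ![1, 1] x = (D.alpha ^ 2 - x 0 ^ 2) * (D.alpha ^ 2 - x 1 ^ 2) := by
  have h := D.q_eq 1 0 x
  simpa [stripWeight] using h

variable {D} {x : Fin 2 → ℝ}

/-- The part of the chamber cut out by `q_{1,0} ≥ 0` and `q_{1,1} ≥ 0`. -/
theorem region_cases (hx : x ∈ chamber 2) (h10 : 0 ≤ D.q ![1, 0] x) (h11 : 0 ≤ D.q ![1, 1] x) :
    (x 0 ≤ D.tau + D.alpha ∧ x 1 ≤ D.alpha) ∨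
      (D.alpha < x 1 ∧ x 1 < 1 + D.alpha ∧ x 0 < D.tau + D.alpha) := by
  have hτ := D.tau_pos
  have hτ1 := D.tau_le_one
  have hα := D.alpha_pos
  have h01 : x 1 ≤ x 0 := hx.1 (Fin.zero_le 1)
  have h1 : 0 ≤ x 1 := hx.2 1
  rw [q_one_zero] at h10
  rw [q_one_one] at h11
  rcases lt_trichotomy (x 1) D.alpha with h | h | h
  -- Here `q_{1,1} ≥ 0` excludes `x 0 > α`, hence also `x 0 > τ + α`.
  · refine Or.inl ⟨?_, h.le⟩
    by_contra! h0
    have : 0 < D.alpha ^ 2 - x 1 ^ 2 := by nlinarith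
    have : D.alpha ^ 2 - x 0 ^ 2 < 0 := by nlinarith
    nlinarith
  · refine Or.inl ⟨?_, h.le⟩
    rw [h] at h10
    exact le_of_sq_le_sq (by linarith) (by linarith)
  · refine Or.inr ⟨h, ?_, ?_⟩
    · by_contra! h2
      nlinarith
    · by_contra! h2
      nlinarith

theorem sq_sub_sq_nonneg_of_le {a b : ℝ} (hb : 0 ≤ b) (h : b ≤ a) : 0 ≤ a ^ 2 - b ^ 2 :=
  sub_nonneg.2 (pow_le_pow_left₀ hb h 2)

theorem second_factor_pos (hx : x ∈ chamber 2) (h1 : x 1 < 1 + D.alpha) (j : ℕ) (hj : 1 ≤ j) :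
    0 < ((j : ℝ) + D.alpha) ^ 2 - x 1 ^ 2 := by
  have : (1 : ℝ) ≤ j := by exact_mod_cast hj
  exact sub_pos.2 (pow_lt_pow_left₀ (by linarith) (hx.2 1) two_ne_zero)

theorem first_factor_pos (hx : x ∈ chamber 2) (h0 : x 0 < D.tau + D.alpha) (j : ℕ) :
    0 < ((j : ℝ) + D.tau + D.alpha) ^ 2 - x 0 ^ 2 :=
  sub_pos.2 (pow_lt_pow_left₀ (by linarith [(Nat.cast_nonneg j : (0 : ℝ) ≤ j)]) (hx.2 0) two_ne_zero)

/-- If all the factors in the definition of `R` are nonnegative, so is `R`. -/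
theorem R_nonneg_of_le (hx : x ∈ chamber 2) (h0 : x 0 ≤ D.tau + D.alpha) (h1 : x 1 ≤ D.alpha) :
    0 ≤ D.R x := by
  refine tsum_nonneg fun k => ?_
  rw [rTerm_eq_prod]
  refine prod_nonneg fun j _ => ?_
  have hj : (0 : ℝ) ≤ j := Nat.cast_nonneg j
  exact div_nonneg
    (mul_nonneg (sq_sub_sq_nonneg_of_le (hx.2 1) (by linarith)) (by linarith [D.tau_pos]))
    (mul_nonneg (sq_sub_sq_nonneg_of_le (hx.2 0) (by linarith)) (by linarith))

/-- The factor `j = 0` is `q_{1,1}`. For `j ≥ 1` both differences are nonnegative, because `τ ≤ 1 ≤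
j`. -/
theorem leading_prod_nonneg (hx : x ∈ chamber 2) (h10 : 0 ≤ D.q ![1, 0] x)
    (h11 : 0 ≤ D.q ![1, 1] x) (l : ℕ) :
    0 ≤ ∏ j ∈ range l,
      (((j : ℝ) + D.alpha) ^ 2 - x 0 ^ 2) * (((j : ℝ) + D.alpha) ^ 2 - x 1 ^ 2) := by
  refine prod_nonneg fun j _ => ?_
  rcases Nat.eq_zero_or_pos j with rfl | hj
  · rw [q_one_one] at h11
    simpa using h11
  · have hj' : (1 : ℝ) ≤ j := by exact_mod_cast hj
    have hτ1 := D.tau_le_one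
    rcases region_cases hx h10 h11 with ⟨h0, h1⟩ | ⟨_, h1, h0⟩ <;>
    exact mul_nonneg (sq_sub_sq_nonneg_of_le (hx.2 0) (by linarith))
      (sq_sub_sq_nonneg_of_le (hx.2 1) (by linarith))

/-- All `q_λ` are nonnegative when `x 1 ≤ ρ₂`, and the `q_λ` with two rows always are. -/
theorem q_nonneg_of_le_or_pos (hx : x ∈ chamber 2) (h10 : 0 ≤ D.q ![1, 0] x)
    (h11 : 0 ≤ D.q ![1, 1] x) {l : ℕ} (hl : x 1 ≤ D.alpha ∨ 0 < l) (m : ℕ) :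
    0 ≤ D.q ![l + m, l] x := by
  rw [q_eq]
  refine mul_nonneg (leading_prod_nonneg hx h10 h11 l) (sum_nonneg fun i _ =>
    mul_nonneg (stripWeight_pos D.tau_pos m i).le (mul_nonneg (prod_nonneg fun j _ => ?_)
      (prod_nonneg fun j _ => ?_)))
  · refine sq_sub_sq_nonneg_of_le (hx.2 1) ?_
    have hj : (0 : ℝ) ≤ ((l + j : ℕ) : ℝ) := Nat.cast_nonneg _
    rcases hl with h | h
    · linarith
    · have hj : (1 : ℝ) ≤ ((l + j : ℕ) : ℝ) := by exact_mod_cast (by omega : 1 ≤ l + j)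
      rcases region_cases hx h10 h11 with ⟨_, h1⟩ | ⟨_, h1, _⟩ <;> linarith
  · refine sq_sub_sq_nonneg_of_le (hx.2 0) ?_
    have hj : (0 : ℝ) ≤ ((l + (i + j) : ℕ) : ℝ) := Nat.cast_nonneg _
    rcases region_cases hx h10 h11 with ⟨h0, _⟩ | ⟨_, _, h0⟩ <;> linarith

/-- For one row, `q_λ` is a positive multiple of a weighted partial sum of the series `R`. -/
theorem q_row_eq (hx : x ∈ chamber 2) (h0 : x 0 < D.tau + D.alpha) (m : ℕ) :
    D.q ![m, 0] x = (∏ j ∈ range m, (((j : ℝ) + D.tau + D.alpha) ^ 2 - x 0 ^ 2)) *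
      ∑ i ∈ range (m + 1),
        stripWeight D.tau m i / (∏ j ∈ range i, rowWeight D.tau j) * D.rTerm x i := by
  have h := D.q_eq 0 m x
  simp only [zero_add, range_zero, prod_empty, one_mul] at h
  rw [h, mul_sum]
  refine sum_congr rfl fun i hi => ?_
  obtain ⟨k, rfl⟩ : ∃ k, m = i + k := Nat.exists_eq_add_of_le (by have := mem_range.1 hi; omega)
  rw [prod_range_add, Nat.add_sub_cancel_left, rTerm_eq_prod]
  -- The product of the `rowWeight`s is `(τ)_i / i!`, which occurs in `rTerm` but not in `q`.
  have e : ∏ j ∈ range i, (((j : ℝ) + D.alpha) ^ 2 - x 1 ^ 2) =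
      (∏ j ∈ range i, (((j : ℝ) + D.tau + D.alpha) ^ 2 - x 0 ^ 2)) *
        (∏ j ∈ range i, (((j : ℝ) + D.alpha) ^ 2 - x 1 ^ 2) * ((j : ℝ) + D.tau) /
          ((((j : ℝ) + D.tau + D.alpha) ^ 2 - x 0 ^ 2) * ((j : ℝ) + 1))) /
        ∏ j ∈ range i, rowWeight D.tau j := by
    rw [← prod_mul_distrib, ← prod_div_distrib]
    refine prod_congr rfl fun j _ => ?_
    have h1 := (first_factor_pos hx h0 j).ne'
    have h2 : (j : ℝ) + 1 ≠ 0 := by positivity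
    have h3 : (j : ℝ) + D.tau ≠ 0 := by have := D.tau_pos; positivity
    unfold rowWeight
    field_simp
  rw [e]
  ring

/-- Exactly one factor, the one with `j = 0`, is negative. -/
theorem rTerm_nonpos (hx : x ∈ chamber 2) (hα : D.alpha < x 1) (h1 : x 1 < 1 + D.alpha)
    (h0 : x 0 < D.tau + D.alpha) (k : ℕ) : D.rTerm x (k + 1) ≤ 0 := by
  rw [rTerm_eq_prod, prod_range_succ']
  have hτ := D.tau_pos
  refine mul_nonpos_of_nonneg_of_nonpos (prod_nonneg fun j _ => ?_) ?_
  · have a := second_factor_pos hx h1 (j + 1) (by omega)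
    have b := first_factor_pos hx h0 (j + 1)
    positivity
  · have b := first_factor_pos hx h0 0
    refine div_nonpos_of_nonpos_of_nonneg (mul_nonpos_of_nonpos_of_nonneg ?_ (by positivity))
      (by positivity)
    have := D.alpha_pos
    push_cast
    nlinarith

theorem R_le_sum_range (hx : x ∈ chamber 2) (hα : D.alpha < x 1) (h1 : x 1 < 1 + D.alpha)
    (h0 : x 0 < D.tau + D.alpha) (m : ℕ) : D.R x ≤ ∑ i ∈ range (m + 1), D.rTerm x i := by
  rw [R, ← (D.summable_rTerm x).sum_add_tsum_nat_add (m + 1)]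
  have : ∑' i, D.rTerm x (i + (m + 1)) ≤ 0 :=
    tsum_nonpos fun i => rTerm_nonpos hx hα h1 h0 (i + m)
  linarith

theorem A0_subset_B : D.A0 ⊆ D.B := by
  rintro x ⟨hx, hq⟩
  have part : ∀ l m, IsPartition ![l + m, l] := by
    intro l m i j hij
    fin_cases i <;> fin_cases j <;> simp at hij ⊢
  have h10 : 0 ≤ D.q ![1, 0] x := hq _ (part 0 1)
  have h11 : 0 ≤ D.q ![1, 1] x := hq _ (part 1 0)
  refine ⟨hx, h10, h11, ?_⟩
  rcases region_cases hx h10 h11 with ⟨h0, h1⟩ | ⟨hα, h1, h0⟩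
  · exact R_nonneg_of_le hx h0 h1
  · refine ge_of_tendsto' ((D.summable_rTerm x).hasSum.tendsto_sum_nat.comp (tendsto_add_atTop_nat 1))
      fun m => ?_
    have h : 0 ≤ D.q ![m, 0] x := by simpa using hq _ (part 0 m)
    rw [q_row_eq hx h0] at h
    refine (nonneg_of_mul_nonneg_right h (prod_pos fun j _ => first_factor_pos hx h0 j)).trans ?_
    refine sum_le_sum fun i _ => ?_
    have hb : 0 < ∏ j ∈ range i, rowWeight D.tau j := prod_pos fun j _ => rowWeight_pos D.tau_pos j
    rcases i with _ | i
    -- The zeroth term, the only positive one, has weight exactly 1.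
    · simp [stripWeight]
    · have hc := (one_le_div hb).2 (prod_rowWeight_le_stripWeight D.tau_pos D.tau_le_one m (i + 1))
      nlinarith [rTerm_nonpos hx hα h1 h0 i]

theorem B_subset_A0_of_tau_eq_one (hτ : D.tau = 1) : D.B ⊆ D.A0 := by
  rintro x ⟨hx, h10, h11, hR⟩
  refine ⟨hx, fun lam hlam => ?_⟩
  obtain ⟨m, hm⟩ := Nat.exists_eq_add_of_le (hlam (Fin.zero_le 1))
  obtain ⟨l, hl⟩ : ∃ l, lam 1 = l := ⟨_, rfl⟩
  have e : lam = ![l + m, l] := by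
    funext i
    fin_cases i
    · simp [hm, hl]
    · simp [hl]
  rw [e]
  rcases region_cases hx h10 h11 with ⟨_, h1⟩ | ⟨hα, h1, h0⟩
  · exact q_nonneg_of_le_or_pos hx h10 h11 (Or.inl h1) m
  · rcases Nat.eq_zero_or_pos l with rfl | hl
    · rw [zero_add, q_row_eq hx h0]
      refine mul_nonneg (prod_nonneg fun j _ => (first_factor_pos hx h0 j).le) ?_
      simpa [hτ, stripWeight_one, rowWeight_one] using
        hR.trans (R_le_sum_range hx hα h1 h0 m)
    · exact q_nonneg_of_le_or_pos hx h10 h11 (Or.inr hl) m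

end RankTwoDomain

end Shimura

/-- The series `R` converges wherever it is used; `𝒜₀ = ℬ` for type `I_{2,2+b}`; `𝒜₀ ⊆ ℬ` for
type `II_2`. -/
theorem theorem5 :
    (∀ (D : Shimura.RankTwoDomain) (x : Fin 2 → ℝ), x ∈ Shimura.chamber 2 →
      0 ≤ D.q ![1, 0] x → 0 ≤ D.q ![1, 1] x → Summable (D.rTerm x)) ∧
    (∀ b : ℕ, (Shimura.RankTwoDomain.typeI b).A0 = (Shimura.RankTwoDomain.typeI b).B) ∧
    Shimura.RankTwoDomain.typeII.A0 ⊆ Shimura.RankTwoDomain.typeII.B :=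
  ⟨fun D x _ _ _ => D.summable_rTerm x,
    fun _ => Set.Subset.antisymm Shimura.RankTwoDomain.A0_subset_B
      (Shimura.RankTwoDomain.B_subset_A0_of_tau_eq_one (by simp [Shimura.RankTwoDomain.tau,
        Shimura.RankTwoDomain.d])),
    Shimura.RankTwoDomain.A0_subset_B⟩
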